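/- **Theorem 5.1 (braid-free qudit teleportation).** Let $n\ge 1$, $G=\mathbb Z_2^n$ and $d=2^n=|G|$. Consider a Tambara–Yamagami theory with charges $\{q\}\cup G$ (so of rank $d+1$) and fusion rules $q\times q=\sum_{g\in G}g$, $q\times g=g\times q=q$, $g\times h=gh$. It is given, in any gauge, by unitary $F$-matrices $[F^{abc}_d]_{fe}$ that satisfy the pentagon equations and are trivial for fusion with the vacuum; a braiding is not used and need not exist. States of anyons on a line are expanded in orthonormal fusion trees, and a change of tree is given by the $F$-matrices. Let $N=2p$ with $p\ge1$. The fusion space $V^{q^{\otimes N}}$ of $N$ anyons of charge $q$ (all total charges together) has dimension $d^{p}$, that is, it encodes $p=N/2$ qudits. Let Alice hold $N$ anyons of charge $q$ in a state $|\varphi\rangle\in V^{q^{\otimes N}}$, and consider the following procedure. 1. To the right of Alice's anyons, $N$ nested pairs $q,q$ are created from the vacuum ($N/2$ maximally entangled pairs of qudits). The left half goes to Alice, the right half to Bob. 2. Alice fuses the rightmost of her original anyons with the leftmost of those she received and measures the outcome $g_N\in G$. She sends $g_N$ to Bob and fuses the resulting anyon $g_N$ with her anyon of charge $q$ to its immediate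 left. She repeats this to obtain $g_{N-1},\dots,g_1$. The last anyon $g_1$ has no left neighbour and is kept. 3. Bob applies corrections for $j=1,2,\dots,N$ in this order. For $j=1$, an anyon $g_1$ is emitted to the left of his first anyon, either (i) by splitting $q\to g_1\,q$, or (ii) by creating a pair $g_1,g_1$ to the left of it and fusing the right member with it. For $j\ge2$, an anyon $g_j$ is exchanged between his anyons $j-1$ and $j$: either (i) anyon $j-1$ splits as $q\to q\,g_j$ and $g_j$ is fused with anyon $j$, or (ii) anyon $j$ splits as $q\to g_j\,q$ and $g_j$ is fused with anyon $j-1$, or (iii) a pair $g_j,g_j$ is created between the two, the left member is fused with anyon $j-1$ and the right member with anyon $j$. Then for all outcomes $g_1,\dots,g_N\in G$ and all choices among these ways of correcting there is $\omega\in\mathbb C$ with $|\omega|=1$, independent of $|\varphi\rangle$, such that the linear operator of the whole process (with projection onto the measured outcomes, not renormalised) is $$|\varphi\rangle\;\longmapsto\; \frac{\omega}{d^{\,N/2}}\;|(g_1g_1)_0\rangle\otimes|\varphi\rangle ,$$ where $|(g_1g_1)_0\rangle$ is the state of the two leftover anyons of charge $g_1$, with vacuum total charge, to the left of Bob's $N$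 anyons. So every sequence of outcomes has probability $d^{-N}$, and the process equals the identity operator on $V^{q^{\otimes N}}$ up to a global phase. No operation of the procedure is a braiding, and if Bob always corrects by pair-creation, then the procedure consists of pair-creations and fusions (with Alice's measurement of outcomes in $G$) only. -/

import Mathlib

open scoped ComplexConjugate

/-- The group `ℤ₂ⁿ`, written additively. -/
abbrev TYGroup (n : ℕ) : Type := Fin n → ZMod 2

/-- The `2ⁿ + 1` charges of a Tambara-Yamagami theory: `some g` is the abelian charge `g ∈ ℤ₂ⁿ`,
`none` is the Tambara-Yamagami charge `q`.  All of them are self-dual. -/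
abbrev TYCharge (n : ℕ) : Type := Option (TYGroup n)

namespace TYCharge

/-- The charge of a Tambara-Yamagami anyon. -/
abbrev q {n : ℕ} : TYCharge n := none

/-- The vacuum. -/
abbrev vac {n : ℕ} : TYCharge n := some 0

/-- The fusion rules `q × q = ∑ g`, `q × g = g × q = q`, `g × h = g h`: the set of charges that
occur (each with multiplicity one) in `a × b`. -/
def fusion {n : ℕ} : TYCharge n → TYCharge n → Finset (TYCharge n)
  | some g, some h => {some (g + h)}
  | some _, none => {none}
  | none, some _ => {none}
  | none, none => Finset.univ.erase none

end TYCharge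

open TYCharge in
/-- Skeletal data of a unitary fusion category with the Tambara-Yamagami fusion rules of `ℤ₂ⁿ`
(in an arbitrary gauge): `F a b c d f e` is the symbol `[F^{abc}_d]_{fe}`, the coefficient of the
tree `(a (b c)_f)_d` in the expansion of the tree `((a b)_e c)_d`. -/
structure TYTheory (n : ℕ) where
  /-- the `F`-symbols -/
  F : TYCharge n → TYCharge n → TYCharge n → TYCharge n → TYCharge n → TYCharge n → ℂ
  /-- entries outside the index range of the `F`-matrices are set to zero -/
  F_eq_zero : ∀ a b c d f e,
    ¬ (e ∈ fusion a b ∧ d ∈ fusion e c ∧ f ∈ fusion b c ∧ d ∈ fusion a f) → F a b c d f e = 0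
  /-- every `F`-matrix has orthonormal columns -/
  F_isometry : ∀ a b c d e e', e ∈ fusion a b → d ∈ fusion e c →
    ∑ f, conj (F a b c d f e) * F a b c d f e' = if e = e' then 1 else 0
  /-- every `F`-matrix has orthonormal rows -/
  F_coisometry : ∀ a b c d f f', f ∈ fusion b c → d ∈ fusion a f →
    ∑ e, F a b c d f e * conj (F a b c d f' e) = if f = f' then 1 else 0
  /-- the pentagon equations -/
  pentagon : ∀ a b c d e p t r s,
    F a b r e s p * F p c d e r t = ∑ u, F b c d s r u * F a u d e s t * F a b c t u p
  /-- fusion with the vacuum is trivial -/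
  triangle : ∀ a b c d f e, a = vac ∨ b = vac ∨ c = vac →
    e ∈ fusion a b → d ∈ fusion e c → f ∈ fusion b c → d ∈ fusion a f → F a b c d f e = 1

/-- A label of a fusion tree for anyons on a line: `[(a₁, x₁), …, (aₖ, xₖ)]` stands for anyons of
charges `a₁, …, aₖ` (from left to right) such that the first `i` of them have total charge `xᵢ`. -/
abbrev TYKet (n : ℕ) : Type := List (TYCharge n × TYCharge n)

/-- Complex combinations of fusion trees (the trees being an orthonormal basis). -/
abbrev TYState (n : ℕ) : Type := TYKet n →₀ ℂ

namespace TYKet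

open TYCharge

/-- The labelling obeys the fusion rules, where `x` is the total charge of whatever is to the left
of the first anyon. -/
def IsAdmissible {n : ℕ} : TYCharge n → TYKet n → Prop
  | _, [] => True
  | x, (a, y) :: s => y ∈ fusion x a ∧ IsAdmissible y s

end TYKet

open TYCharge in
/-- The fusion space `V^{a₁ … aₖ}` (all total charges together) of anyons of charges
`w = [a₁, …, aₖ]`. -/
noncomputable def fusionSpace {n : ℕ} (w : List (TYCharge n)) : Submodule ℂ (TYState n) :=
  Finsupp.supported ℂ ℂ {v : TYKet n | v.map Prod.fst = w ∧ TYKet.IsAdmissible vac v}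

/-- Elementary operations on a line of anyons; positions are counted from `0`. There is no
exchange of anyons among them. -/
inductive TYOp (n : ℕ) : Type
  /-- create from the vacuum a pair of anyons of charge `a`, so that they get the positions
  `k` and `k + 1` -/
  | create (k : ℕ) (a : TYCharge n)
  /-- fuse the anyons at positions `k` and `k + 1`, with outcome `c` -/
  | fuse (k : ℕ) (c : TYCharge n)
  /-- split the anyon at position `k` into anyons of charges `a` (left) and `b` (right) -/
  | split (k : ℕ) (a b : TYCharge n)

/-- The operation is a pair-creation or a fusion. -/
def TYOp.IsCreateOrFuse {n : ℕ} : TYOp n → Prop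
  | .create _ _ => True
  | .fuse _ _ => True
  | .split _ _ _ => False

namespace TYTheory

open TYCharge

variable {n : ℕ}

/-- Pair-creation immediately to the right of anyons of total charge `x`:
`x ↦ (x (a a)₀)ₓ = ∑ y, [G^{xaa}_x]_{y0} ((x a)_y a)ₓ`, where `G = F⁻¹ = F†`. -/
noncomputable def createKet (T : TYTheory n) (a x : TYCharge n) (s : TYKet n) : TYState n :=
  ∑ y, Finsupp.single ((a, y) :: (a, x) :: s) (conj (T.F x a a x vac y))

/-- Fusion with outcome `c` of the first two anyons to the right of anyons of total charge `x`:
the component `[F^{xab}_z]_{cy} (x (a b)_c)_z` of `((x a)_y b)_z`, in which the pair is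
from now on regarded as one anyon of charge `c`. -/
noncomputable def fuseKet (T : TYTheory n) (c x : TYCharge n) : TYKet n → TYState n
  | (a, y) :: (b, z) :: s => Finsupp.single ((c, z) :: s) (T.F x a b z c y)
  | _ => 0

/-- Splitting into `a`, `b` of the first anyon to the right of anyons of total charge `x`:
`(x c)_z ↦ (x (a b)_c)_z = ∑ y, [G^{xab}_z]_{yc} ((x a)_y b)_z`. -/
noncomputable def splitKet (T : TYTheory n) (a b x : TYCharge n) : TYKet n → TYState n
  | (c, z) :: s => ∑ y, Finsupp.single ((a, y) :: (b, z) :: s) (conj (T.F x a b z c y))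
  | [] => 0

/-- Apply a local rule after skipping the first `k` anyons; the rule is told the total charge of
everything to the left of the place where it acts. -/
noncomputable def skip (R : TYCharge n → TYKet n → TYState n) :
    ℕ → TYCharge n → TYKet n → TYState n
  | 0, x, s => R x s
  | _ + 1, _, [] => 0
  | k + 1, _, (a, y) :: s => Finsupp.mapDomain (fun v => (a, y) :: v) (skip R k y s)

/-- The linear operator of an elementary operation. For a fusion it is the (unnormalised)
operator for the measurement outcome `c`: the squared norm of its value at a unit vector is the
probability of that outcome. -/
noncomputable def op (T : TYTheory n) : TYOp n → TYState n →ₗ[ℂ] TYState n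
  | .create k a => Finsupp.linearCombination ℂ (skip (T.createKet a) k vac)
  | .fuse k c => Finsupp.linearCombination ℂ (skip (T.fuseKet c) k vac)
  | .split k a b => Finsupp.linearCombination ℂ (skip (T.splitKet a b) k vac)

/-- The linear operator of a sequence of elementary operations, performed from first to last. -/
noncomputable def run (T : TYTheory n) : List (TYOp n) → TYState n →ₗ[ℂ] TYState n
  | [] => LinearMap.id
  | o :: os => (run T os).comp (T.op o)

end TYTheory

/-- The ways in which Bob may apply one of his corrections. -/
inductive BobMethod : Type
  /-- an abelian anyon is split off and absorbed by the neighbour to the right -/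
  | splitFromLeft
  /-- an abelian anyon is split off and absorbed by the neighbour to the left -/
  | splitFromRight
  /-- a pair of abelian anyons is created from the vacuum and absorbed -/
  | pairCreate

namespace Teleport

open TYCharge

variable {n : ℕ}

/-- Phase 1: to the right of Alice's `N` anyons, `N` nested pairs of Tambara-Yamagami anyons are
created (that is, `N / 2` e-dits). The left half goes to Alice, the right half to Bob. -/
def charlie (n N : ℕ) : List (TYOp n) :=
  (List.range N).map fun k => TYOp.create (N + k) q

/-- Phase 2: Alice fuses the rightmost of her anyons with the leftmost of those sent by Charlie,
with outcome `g j`; the outcome is then fused with the anyon of hers to the immediate left; and so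
on for `j = N - 1, …, 0`. The last outcome `g 0` stays at the far left. -/
def alice {N : ℕ} (g : Fin N → TYGroup n) : List (TYOp n) :=
  (List.finRange N).reverse.flatMap fun j : Fin N =>
    TYOp.fuse (j : ℕ) (some (g j)) ::
      if (j : ℕ) = 0 then [] else [TYOp.fuse ((j : ℕ) - 1) q]

/-- One of Bob's corrections. For `j = 0`, an anyon of charge `h` is emitted to the left of Bob's
first anyon and left over (either by splitting, or by creating a pair of which the right member is
absorbed). For `j ≥ 1`, an anyon of charge `h` is exchanged between Bob's anyons `j - 1` and `j`,
which are at positions `j + 1` and `j + 2`. -/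
def correction (h : TYGroup n) : ℕ → BobMethod → List (TYOp n)
  | 0, .splitFromLeft => [TYOp.split 1 (some h) q]
  | 0, .splitFromRight => [TYOp.split 1 (some h) q]
  | 0, .pairCreate => [TYOp.create 1 (some h), TYOp.fuse 2 q]
  | j + 1, .splitFromLeft => [TYOp.split (j + 2) q (some h), TYOp.fuse (j + 3) q]
  | j + 1, .splitFromRight => [TYOp.split (j + 3) (some h) q, TYOp.fuse (j + 2) q]
  | j + 1, .pairCreate => [TYOp.create (j + 3) (some h), TYOp.fuse (j + 2) q, TYOp.fuse (j + 3) q]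

/-- Phase 3: Bob's corrections, according to the outcomes received from Alice. -/
def bob {N : ℕ} (g : Fin N → TYGroup n) (m : Fin N → BobMethod) : List (TYOp n) :=
  (List.finRange N).flatMap fun j : Fin N => correction (g j) (j : ℕ) (m j)

/-- The whole procedure, when Alice's outcomes are `g` and Bob uses the methods `m`. -/
def procedure {N : ℕ} (g : Fin N → TYGroup n) (m : Fin N → BobMethod) : List (TYOp n) :=
  charlie n N ++ alice g ++ bob g m

/-- `φ ↦ |(h h)₀⟩ ⊗ φ`: the state `φ`, with two anyons of charge `h` and of vacuum total charge to
its left. -/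
noncomputable def withAncilla (h : TYGroup n) : TYState n →ₗ[ℂ] TYState n :=
  Finsupp.lmapDomain ℂ ℂ fun v => (some h, some h) :: (some h, vac) :: v

end Teleport

/-! Creating a pair `q q` to the right of an anyon `q` and fusing that anyon with the left member to
`g` equals, up to the scalar `conj (F q q q q vac g)`, splitting `q` into `g q`; this is a
consequence of the pentagon and unitarity (`conj_F_vac_mul_F`, `act_fuse_act_create_eq_split`).
Alice's next fusion lets the left neighbour absorb `g`, so each of her steps is a multiple of an
`exchange` of `g` between neighbouring anyons, and the last one is an emission of `g` at the left
end. Fusions commute with the pair-creations to their right, so each measurement can be moved next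
to the single pair that it uses (`run_creates_aliceSteps`).

On trees, an exchange shifts the one running charge between the two anyons by `g` and multiplies by
a phase. The phase may depend on the tree, but each of Bob's corrections undoes the exchange up to a
phase that does not (`exchangeRight_exchange`, `exchange_exchange`). Bob works in the order opposite
to Alice's, so the composite telescopes. The remaining scalar is a product of entries of `F q q q
q`, each of squared modulus `1 / 2 ^ n` (`norm_F_q_vac_sq`). -/

namespace TYCharge

variable {n : ℕ}

/-! ### Fusion rules with abelian charges -/

theorem mem_fusion_vac_left {a z : TYCharge n} : z ∈ fusion vac a ↔ z = a := by
  cases a <;> simp [fusion]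

theorem mem_fusion_vac_right {a z : TYCharge n} : z ∈ fusion a vac ↔ z = a := by
  cases a <;> simp [fusion]

theorem tyGroup_add_self (h : TYGroup n) : h + h = 0 :=
  funext fun i => CharTwo.add_self_eq_zero (h i)

theorem vac_mem_fusion_self (a : TYCharge n) : vac ∈ fusion a a := by
  cases a with
  | none => simp [fusion]
  | some h => simp [fusion, vac, tyGroup_add_self]

/-- The result of fusing a charge with an abelian charge. -/
def shift (h : TYGroup n) (x : TYCharge n) : TYCharge n := x.map (· + h)

theorem mem_fusion_some {x z : TYCharge n} {h : TYGroup n} :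
    z ∈ fusion x (some h) ↔ z = shift h x := by
  cases x <;> simp [fusion, shift]

theorem shift_shift (h : TYGroup n) (x : TYCharge n) : shift h (shift h x) = x := by
  cases x <;> simp [shift, add_assoc, tyGroup_add_self]

theorem eq_shift_iff {h : TYGroup n} {x y : TYCharge n} : y = shift h x ↔ x = shift h y := by
  constructor <;> rintro rfl <;> rw [shift_shift]

theorem mem_fusion_some_q {z : TYCharge n} {h : TYGroup n} : z ∈ fusion (some h) q ↔ z = q := by
  simp [fusion]

theorem mem_fusion_shift_q {y z : TYCharge n} (h : TYGroup n) (hz : z ∈ fusion y q) :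
    z ∈ fusion (shift h y) q := by
  cases y <;> simpa [fusion, shift] using hz

theorem shift_mem_fusion_q {x y : TYCharge n} (h : TYGroup n) (hy : y ∈ fusion x q) :
    shift h y ∈ fusion x q := by
  cases x <;> cases y <;> simp_all [fusion, shift]

end TYCharge

/-! ### Consequences of the pentagon and of unitarity for the `F`-symbols -/

namespace TYTheory

open TYCharge

variable {n : ℕ} (T : TYTheory n)

/-- Only one term survives in the norm of the column. All phases below arise from such entries. -/
theorem F_mul_conj_of_unique {a b c d f e : TYCharge n} (hf : ∀ f', f' ∈ fusion b c → f' = f)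
    (he : e ∈ fusion a b) (hd : d ∈ fusion e c) :
    conj (T.F a b c d f e) * T.F a b c d f e = 1 := by
  have h := T.F_isometry a b c d e e he hd
  rw [if_pos rfl, Finset.sum_eq_single f] at h
  · exact h
  · intro f' _ hne
    rw [T.F_eq_zero a b c d f' e (fun hh => hne (hf _ hh.2.2.1)), mul_zero]
  · simp

theorem norm_eq_one_of_conj_mul {z : ℂ} (h : conj z * z = 1) : ‖z‖ = 1 := by
  rw [Complex.conj_mul'] at h
  have h' : ‖z‖ ^ 2 = 1 := by exact_mod_cast h
  exact (pow_eq_one_iff_of_nonneg (norm_nonneg z) two_ne_zero).1 h'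

/-- The pentagon equation, read along the two paths from `(a b) (c d)` to `(a (b c)) d`. -/
theorem pentagon_rotated {a b c d e p t r u : TYCharge n} (hu : u ∈ fusion b c)
    (ht : t ∈ fusion a u) (het : e ∈ fusion t d) (hr : r ∈ fusion c d) (her : e ∈ fusion p r) :
    conj (T.F p c d e r t) * T.F a b c t u p =
      ∑ s, T.F a b r e s p * conj (T.F b c d s r u) * conj (T.F a u d e s t) := by
  -- Contracting the pentagon with a column of `F b c d s` removes its sum over `u`. `h2` and `h3`
  -- then move the other two factors across by unitarity.
  have h1 : ∀ s t', ∑ r', conj (T.F b c d s r' u) * (T.F a b r' e s p * T.F p c d e r' t') =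
      T.F a u d e s t' * T.F a b c t' u p := by
    intro s t'
    by_cases hs : s ∈ fusion u d
    · simp_rw [T.pentagon, Finset.mul_sum]
      rw [Finset.sum_comm, Finset.sum_eq_single u]
      · have := T.F_isometry b c d s u u hu hs
        rw [if_pos rfl] at this
        calc _ = (∑ r', conj (T.F b c d s r' u) * T.F b c d s r' u) *
              (T.F a u d e s t' * T.F a b c t' u p) := by
              rw [Finset.sum_mul]; exact Finset.sum_congr rfl fun _ _ => by ring
          _ = _ := by rw [this, one_mul]
      · intro u' _ hne
        have := T.F_isometry b c d s u u' hu hs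
        rw [if_neg hne.symm] at this
        calc _ = (∑ r', conj (T.F b c d s r' u) * T.F b c d s r' u') *
              (T.F a u' d e s t' * T.F a b c t' u' p) := by
              rw [Finset.sum_mul]; exact Finset.sum_congr rfl fun _ _ => by ring
          _ = _ := by rw [this, zero_mul]
      · simp
    · rw [T.F_eq_zero a u d e s t' (fun hh => hs hh.2.2.1), zero_mul]
      refine Finset.sum_eq_zero fun r' _ => ?_
      rw [T.F_eq_zero b c d s r' u (fun hh => hs hh.2.1), map_zero, zero_mul]
  have h2 : ∀ t', ∑ s, conj (T.F a u d e s t) * (T.F a u d e s t' * T.F a b c t' u p) =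
      (if t = t' then 1 else 0) * T.F a b c t' u p := by
    intro t'
    rw [← T.F_isometry a u d e t t' ht het, Finset.sum_mul]
    exact Finset.sum_congr rfl fun _ _ => by ring
  have h3 : ∀ r', ∑ t', conj (T.F p c d e r t') * T.F p c d e r' t' =
      if r = r' then 1 else 0 := by
    intro r'
    have := congrArg conj (T.F_coisometry p c d e r r' hr her)
    rw [map_sum, apply_ite conj, map_one, map_zero] at this
    rw [← this]
    exact Finset.sum_congr rfl fun _ _ => by simp
  calc conj (T.F p c d e r t) * T.F a b c t u p
      = ∑ t', conj (T.F p c d e r t') * ((if t = t' then 1 else 0) * T.F a b c t' u p) := by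
        simp
    _ = ∑ t', conj (T.F p c d e r t') * ∑ s, conj (T.F a u d e s t) *
          ∑ r', conj (T.F b c d s r' u) * (T.F a b r' e s p * T.F p c d e r' t') := by
        simp_rw [← h2, h1]
    _ = ∑ s, ∑ r', conj (T.F a u d e s t) * conj (T.F b c d s r' u) * T.F a b r' e s p *
          ∑ t', conj (T.F p c d e r t') * T.F p c d e r' t' := by
        simp_rw [Finset.mul_sum]
        rw [Finset.sum_comm]
        refine Finset.sum_congr rfl fun s _ => ?_
        rw [Finset.sum_comm]
        exact Finset.sum_congr rfl fun _ _ => Finset.sum_congr rfl fun _ _ => by ring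
    _ = _ := by
        simp_rw [h3]
        simp only [mul_ite, mul_one, mul_zero, Finset.sum_ite_eq, Finset.mem_univ, if_true]
        exact Finset.sum_congr rfl fun _ _ => by ring

/-- The `F`-symbols behind: creating a pair `b b` to the right of `a` and fusing `a b` to `c`
splits `a` into `c b`. -/
theorem conj_F_vac_mul_F {x a y : TYCharge n} (b c w : TYCharge n) (hy : y ∈ fusion x a) :
    conj (T.F y b b y vac w) * T.F x a b w c y =
      conj (T.F a b b a vac c) * conj (T.F x c b y a w) := by
  -- Unitarity is available only for admissible labels; for the others both sides vanish by
  -- `F_eq_zero`.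
  by_cases hc : c ∈ fusion a b
  swap
  · rw [T.F_eq_zero x a b w c y (fun hh => hc hh.2.2.1),
      T.F_eq_zero a b b a vac c (fun hh => hc hh.1)]
    simp
  by_cases hw : w ∈ fusion x c
  swap
  · rw [T.F_eq_zero x a b w c y (fun hh => hw hh.2.2.2),
      T.F_eq_zero x c b y a w (fun hh => hw hh.1)]
    simp
  by_cases hyw : y ∈ fusion w b
  swap
  · rw [T.F_eq_zero y b b y vac w (fun hh => hyw hh.2.1),
      T.F_eq_zero x c b y a w (fun hh => hyw hh.2.1)]
    simp
  rw [T.pentagon_rotated hc hw hyw (vac_mem_fusion_self b) (mem_fusion_vac_right.2 rfl),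
    Finset.sum_eq_single a]
  · rw [T.triangle x a vac y a y (by simp) hy (mem_fusion_vac_right.2 rfl)
      (mem_fusion_vac_right.2 rfl) hy, one_mul]
  · intro s _ hs
    rw [T.F_eq_zero x a vac y s y (fun hh => hs (mem_fusion_vac_right.1 hh.2.2.1))]
    simp
  · simp

/-- The pentagon for `h, q, q, q` relates the two entries by three unimodular factors, since its
inner label is forced to be `k`. -/
theorem norm_F_q_add (r h k : TYGroup n) :
    ‖T.F q q q q (some r) (some (h + k))‖ = ‖T.F q q q q (some r) (some k)‖ := by
  have h1 := T.pentagon (some h) q q q q q (some (h + k)) (some r) q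
  rw [Finset.sum_eq_single (some k)] at h1
  · have n1 : ‖T.F (some h) q (some r) q q q‖ = 1 :=
      norm_eq_one_of_conj_mul (T.F_mul_conj_of_unique (by simp [fusion]) (by simp [fusion])
        (by simp [fusion]))
    have n2 : ‖T.F (some h) (some k) q q q (some (h + k))‖ = 1 :=
      norm_eq_one_of_conj_mul (T.F_mul_conj_of_unique (by simp [fusion]) (by simp [fusion])
        (by simp [fusion]))
    -- Here `q × q` has many channels and uniqueness comes from the total charge `h + k`, so the row
    -- is used instead of the column.
    have n3 : ‖T.F (some h) q q (some (h + k)) (some k) q‖ = 1 := by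
      have h3 := T.F_coisometry (some h) q q (some (h + k)) (some k) (some k) (by simp [fusion])
        (by simp [fusion])
      rw [if_pos rfl, Finset.sum_eq_single q] at h3
      · exact norm_eq_one_of_conj_mul (by rw [mul_comm]; exact h3)
      · intro e _ he
        rw [T.F_eq_zero _ _ _ _ _ e (fun hh => he (mem_fusion_some_q.1 hh.1)), zero_mul]
      · simp
    have := congrArg norm h1
    simpa [n1, n2, n3] using this
  · intro u _ hu
    rw [T.F_eq_zero (some h) q q (some (h + k)) u q]
    · simp
    · rintro ⟨-, -, hu1, hu2⟩
      cases u with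
      | none => simp [fusion] at hu1
      | some u => simp [fusion] at hu2; simp [hu2] at hu
  · simp

/-- The vacuum row is a unit vector with `2 ^ n` entries of equal modulus; the entry at `q` is zero.
-/
theorem norm_F_q_vac_sq (h : TYGroup n) : ‖T.F q q q q vac (some h)‖ ^ 2 = ((2 : ℝ) ^ n)⁻¹ := by
  have h1 := T.F_coisometry q q q q vac vac (by simp [fusion]) (by simp [fusion])
  rw [if_pos rfl] at h1
  simp_rw [Complex.mul_conj'] at h1
  have h2 : ∑ e, ‖T.F q q q q vac e‖ ^ 2 = (1 : ℝ) := by exact_mod_cast h1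
  rw [Fintype.sum_option, T.F_eq_zero q q q q vac none (by simp [fusion])] at h2
  have h3 : ∀ k, ‖T.F q q q q vac (some k)‖ = ‖T.F q q q q vac (some h)‖ := fun k => by
    simpa using T.norm_F_q_add 0 (k - h) h
  simp_rw [h3] at h2
  simp at h2
  exact eq_inv_of_mul_eq_one_right h2

end TYTheory

/-! ### Local operators on fusion trees, and exchanges of abelian anyons -/

namespace TYTheory

open TYCharge TYKet

variable {n : ℕ} (T : TYTheory n)

/-- A local rule, applied after skipping `k` anyons, as a linear operator; `x` is the total charge
to the left of the line. -/
noncomputable def act (R : TYCharge n → TYKet n → TYState n) (k : ℕ) (x : TYCharge n) :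
    TYState n →ₗ[ℂ] TYState n :=
  Finsupp.linearCombination ℂ (skip R k x)

/-- Put one more labelled anyon to the left of all trees. -/
noncomputable def consMap (c : TYCharge n × TYCharge n) : TYState n →ₗ[ℂ] TYState n :=
  Finsupp.lmapDomain ℂ ℂ fun v => c :: v

theorem consMap_single (c : TYCharge n × TYCharge n) (v : TYKet n) (r : ℂ) :
    consMap c (Finsupp.single v r) = Finsupp.single (c :: v) r := by
  simp [consMap]

theorem act_single (R : TYCharge n → TYKet n → TYState n) (k : ℕ) (x : TYCharge n) (v : TYKet n)
    (r : ℂ) : act R k x (Finsupp.single v r) = r • skip R k x v := by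
  simp [act]

theorem act_single_nil (R : TYCharge n → TYKet n → TYState n) (k : ℕ) (x : TYCharge n) (r : ℂ) :
    act R (k + 1) x (Finsupp.single [] r) = 0 := by
  simp [act_single, skip]

theorem act_single_cons (R : TYCharge n → TYKet n → TYState n) (k : ℕ) (x a y : TYCharge n)
    (s : TYKet n) (r : ℂ) :
    act R (k + 1) x (Finsupp.single ((a, y) :: s) r) =
      consMap (a, y) (act R k y (Finsupp.single s r)) := by
  simp [act_single, skip, consMap]

/-- An arbitrary charge `x` to the left is allowed so that the leftmost anyon can be peeled off.
Local identities thereby reduce to position `0`. -/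
theorem act_consMap (R : TYCharge n → TYKet n → TYState n) (k : ℕ) (x a y : TYCharge n)
    (ψ : TYState n) : act R (k + 1) x (consMap (a, y) ψ) = consMap (a, y) (act R k y ψ) := by
  induction ψ using Finsupp.induction_linear with
  | zero => simp
  | add f g hf hg => simp [hf, hg]
  | single s r => rw [consMap_single, act_single_cons]

theorem sum_single_eq {ι : Type*} [Fintype ι] (f : ι → TYKet n) (c : ι → ℂ) (i : ι)
    (h : ∀ j, j ≠ i → c j = 0) :
    ∑ j, Finsupp.single (f j) (c j) = Finsupp.single (f i) (c i) := by
  rw [Finset.sum_eq_single i]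
  · intro j _ hj
    rw [h j hj, Finsupp.single_zero]
  · simp

theorem act_create_zero (a x : TYCharge n) (s : TYKet n) (r : ℂ) :
    act (T.createKet a) 0 x (Finsupp.single s r) =
      ∑ y, Finsupp.single ((a, y) :: (a, x) :: s) (r * conj (T.F x a a x vac y)) := by
  simp [act_single, skip, createKet, Finset.smul_sum]

theorem act_fuse_zero (c x a y b z : TYCharge n) (s : TYKet n) (r : ℂ) :
    act (T.fuseKet c) 0 x (Finsupp.single ((a, y) :: (b, z) :: s) r) =
      Finsupp.single ((c, z) :: s) (r * T.F x a b z c y) := by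
  simp [act_single, skip, fuseKet]

theorem act_split_zero (a b x c z : TYCharge n) (s : TYKet n) (r : ℂ) :
    act (T.splitKet a b) 0 x (Finsupp.single ((c, z) :: s) r) =
      ∑ y, Finsupp.single ((a, y) :: (b, z) :: s) (r * conj (T.F x a b z c y)) := by
  simp [act_single, skip, splitKet, Finset.smul_sum]

theorem act_fuse_zero_consMap (c x a y b z : TYCharge n) (ψ : TYState n) :
    act (T.fuseKet c) 0 x (consMap (a, y) (consMap (b, z) ψ)) =
      T.F x a b z c y • consMap (c, z) ψ := by
  induction ψ using Finsupp.induction_linear with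
  | zero => simp
  | add f g hf hg => simp [hf, hg]
  | single s r => simp [consMap_single, act_fuse_zero, mul_comm]

/-- A fusion commutes with a pair-creation to its right. -/
theorem act_fuse_act_create (c a : TYCharge n) (k m : ℕ) (x : TYCharge n) (ψ : TYState n) :
    act (T.fuseKet c) k x (act (T.createKet a) (k + 2 + m) x ψ) =
      act (T.createKet a) (k + 1 + m) x (act (T.fuseKet c) k x ψ) := by
  induction ψ using Finsupp.induction_linear with
  | zero => simp
  | add f g hf hg => simp [hf, hg]
  | single v r =>
    induction k generalizing x v with
    | zero =>
      rw [show 0 + 2 + m = (m + 1) + 1 by ring, show 0 + 1 + m = m + 1 by ring]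
      match v with
      | [] => rw [act_single_nil]; simp [act_single, skip, fuseKet]
      | [(b, y)] => rw [act_single_cons, act_single_nil]; simp [act_single, skip, fuseKet]
      | (b, y) :: (d, z) :: s =>
        rw [act_single_cons, act_single_cons, act_fuse_zero_consMap, act_fuse_zero,
          act_single_cons, ← map_smul, ← map_smul, Finsupp.smul_single, smul_eq_mul, mul_comm]
    | succ k ih =>
      rw [show k + 1 + 2 + m = (k + 2 + m) + 1 by ring, show k + 1 + 1 + m = (k + 1 + m) + 1 by ring]
      match v with
      | [] => simp [act_single_nil]
      | (b, y) :: s =>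
      have := ih y s
      rw [show k + 2 + m = k + 1 + m + 1 by ring] at this
      simp only [act_single_cons, act_consMap, this]

/-- Creating a pair `b b` to the right of an anyon `a` and fusing `a` with its left member is a
multiple of splitting `a` into `c b`. -/
theorem act_fuse_act_create_eq_split {a : TYCharge n} (b c : TYCharge n) (k : ℕ) (x : TYCharge n)
    (v : TYKet n) (hv : IsAdmissible x v) (hk : (v.map Prod.fst)[k]? = some a) :
    act (T.fuseKet c) k x (act (T.createKet b) (k + 1) x (Finsupp.single v 1)) =
      conj (T.F a b b a vac c) • act (T.splitKet c b) k x (Finsupp.single v 1) := by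
  induction k generalizing x v with
  | zero =>
    match v with
    | [] => simp at hk
    | (a', y) :: s =>
      obtain rfl : a' = a := by simpa using hk
      simp only [act_single_cons, act_create_zero, act_split_zero, map_sum, consMap_single,
        act_fuse_zero, Finset.smul_sum, Finsupp.smul_single, smul_eq_mul, one_mul]
      exact Finset.sum_congr rfl fun w _ => by rw [T.conj_F_vac_mul_F b c w hv.1]
  | succ k ih =>
    match v with
    | [] => simp at hk
    | (a', y) :: s =>
      simp only [act_single_cons, act_consMap, ih y s hv.2 (by simpa using hk), map_smul]

/-- An anyon of charge `h` is split off from the Tambara-Yamagami anyon at position `k + 1` and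
absorbed by the one at position `k`. -/
noncomputable def exchange (h : TYGroup n) (k : ℕ) (x : TYCharge n) : TYState n →ₗ[ℂ] TYState n :=
  act (T.fuseKet q) k x ∘ₗ act (T.splitKet (some h) q) (k + 1) x

/-- An anyon of charge `h` is split off from the Tambara-Yamagami anyon at position `k` and
absorbed by the one at position `k + 1`. -/
noncomputable def exchangeRight (h : TYGroup n) (k : ℕ) (x : TYCharge n) :
    TYState n →ₗ[ℂ] TYState n :=
  act (T.fuseKet q) (k + 1) x ∘ₗ act (T.splitKet q (some h)) k x

theorem exchange_single_cons (h : TYGroup n) (k : ℕ) (x a y : TYCharge n) (s : TYKet n) (r : ℂ) :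
    T.exchange h (k + 1) x (Finsupp.single ((a, y) :: s) r) =
      consMap (a, y) (T.exchange h k y (Finsupp.single s r)) := by
  simp only [exchange, LinearMap.comp_apply, act_single_cons, act_consMap]

theorem exchange_consMap (h : TYGroup n) (k : ℕ) (x a y : TYCharge n) (ψ : TYState n) :
    T.exchange h (k + 1) x (consMap (a, y) ψ) = consMap (a, y) (T.exchange h k y ψ) := by
  simp only [exchange, LinearMap.comp_apply, act_consMap]

theorem exchangeRight_consMap (h : TYGroup n) (k : ℕ) (x a y : TYCharge n) (ψ : TYState n) :
    T.exchangeRight h (k + 1) x (consMap (a, y) ψ) = consMap (a, y) (T.exchangeRight h k y ψ) := by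
  simp only [exchangeRight, LinearMap.comp_apply, act_consMap]

/-- The sum over intermediate charges has one term because fusion with `h` has a single outcome. No
admissibility is needed, as inadmissible symbols are zero. -/
theorem exchange_zero (h : TYGroup n) (x y z : TYCharge n) (s : TYKet n) (r : ℂ) :
    T.exchange h 0 x (Finsupp.single ((q, y) :: (q, z) :: s) r) =
      Finsupp.single ((q, shift h y) :: (q, z) :: s)
        (r * conj (T.F y (some h) q z q (shift h y)) * T.F x q (some h) (shift h y) q y) := by
  simp only [exchange, LinearMap.comp_apply, act_single_cons, act_split_zero, map_sum,
    consMap_single, act_fuse_zero]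
  rw [sum_single_eq _ _ (shift h y)]
  intro w hw
  rw [T.F_eq_zero y (some h) q z q w (fun hh => hw (mem_fusion_some.1 hh.1))]
  simp

theorem exchangeRight_zero (h : TYGroup n) (x y z : TYCharge n) (s : TYKet n) (r : ℂ) :
    T.exchangeRight h 0 x (Finsupp.single ((q, y) :: (q, z) :: s) r) =
      Finsupp.single ((q, shift h y) :: (q, z) :: s)
        (r * conj (T.F x q (some h) y q (shift h y)) * T.F (shift h y) (some h) q z q y) := by
  simp only [exchangeRight, LinearMap.comp_apply, act_single_cons, act_split_zero, map_sum,
    consMap_single, act_fuse_zero]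
  rw [sum_single_eq _ _ (shift h y)]
  intro w hw
  rw [T.F_eq_zero x q (some h) y q w (fun hh => hw (eq_shift_iff.1 (mem_fusion_some.1 hh.2.1)))]
  simp

theorem F_some_q_unit (h : TYGroup n) {y z : TYCharge n} (hz : z ∈ fusion y q) :
    conj (T.F y (some h) q z q (shift h y)) * T.F y (some h) q z q (shift h y) = 1 :=
  T.F_mul_conj_of_unique (fun _ => mem_fusion_some_q.1) (mem_fusion_some.2 rfl)
    (mem_fusion_shift_q h hz)

theorem F_q_some_unit (h : TYGroup n) {x y : TYCharge n} (hy : y ∈ fusion x q) :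
    conj (T.F x q (some h) (shift h y) q y) * T.F x q (some h) (shift h y) q y = 1 :=
  T.F_mul_conj_of_unique (by simp [fusion]) hy (mem_fusion_some.2 rfl)

theorem F_some_some_vac_unit (h : TYGroup n) (y : TYCharge n) :
    conj (T.F y (some h) (some h) y vac (shift h y)) *
      T.F y (some h) (some h) y vac (shift h y) = 1 :=
  T.F_mul_conj_of_unique (by simp [fusion, tyGroup_add_self]) (mem_fusion_some.2 rfl)
    (mem_fusion_some.2 (shift_shift h y).symm)

/-- Two successive emissions of `h` to the left of a Tambara-Yamagami anyon. -/
theorem F_some_q_mul (h : TYGroup n) {y z : TYCharge n} (hz : z ∈ fusion y q) :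
    T.F y (some h) q z q (shift h y) * T.F (shift h y) (some h) q z q y =
      T.F (some h) (some h) q q q vac * T.F y (some h) (some h) y vac (shift h y) := by
  rw [T.pentagon, Finset.sum_eq_single vac]
  · rw [T.triangle y vac q z q y (by simp) (mem_fusion_vac_right.2 rfl) hz (by simp [fusion])
      (by simpa using hz), mul_one]
  · intro u _ hu
    rw [T.F_eq_zero (some h) (some h) q q q u
      (fun hh => hu (by simpa [fusion, tyGroup_add_self] using hh.1))]
    simp
  · simp

/-- Two successive absorptions of `h` from the right by a Tambara-Yamagami anyon. -/
theorem F_q_some_mul (h : TYGroup n) {x y : TYCharge n} (hy : y ∈ fusion x q) :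
    T.F y (some h) (some h) y vac (shift h y) = T.F q (some h) (some h) q vac q *
      (T.F x q (some h) y q (shift h y) * T.F x q (some h) (shift h y) q y) := by
  have := T.pentagon x q (some h) (some h) y y (shift h y) vac q
  rw [T.triangle x q vac y q y (by simp) hy (mem_fusion_vac_right.2 rfl)
    (mem_fusion_vac_right.2 rfl) hy, one_mul, Finset.sum_eq_single q] at this
  · rw [this, mul_assoc]
  · intro u _ hu
    rw [T.F_eq_zero q (some h) (some h) q vac u (fun hh => hu (by simpa [fusion] using hh.1))]
    simp
  · simp

/-- Exchanging an anyon to the left and then one to the right has no effect. -/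
theorem exchangeRight_exchange (h : TYGroup n) (k : ℕ) (x : TYCharge n) (v : TYKet n)
    (hv : IsAdmissible x v) (hk : (v.map Prod.fst)[k]? = some q)
    (hk' : (v.map Prod.fst)[k + 1]? = some q) :
    T.exchangeRight h k x (T.exchange h k x (Finsupp.single v 1)) = Finsupp.single v 1 := by
  induction k generalizing x v with
  | zero =>
    match v with
    | [] => simp at hk
    | [_] => simp at hk'
    | (a, y) :: (b, z) :: s =>
      obtain rfl : a = q := by simpa using hk
      obtain rfl : b = q := by simpa using hk'
      obtain ⟨hy, hz, -⟩ := hv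
      rw [exchange_zero, exchangeRight_zero, shift_shift]
      congr 1
      linear_combination T.F_some_q_unit h hz *
        (conj (T.F x q (some h) (shift h y) q y) * T.F x q (some h) (shift h y) q y) +
        T.F_q_some_unit h hy
  | succ k ih =>
    match v with
    | [] => simp at hk
    | (a, y) :: s =>
      rw [exchange_single_cons, exchangeRight_consMap,
        ih y s hv.2 (by simpa using hk) (by simpa using hk'), consMap_single]

/-- Exchanging an abelian anyon twice in the same direction is a multiple of the identity. -/
theorem exchange_exchange (h : TYGroup n) (k : ℕ) (x : TYCharge n) (v : TYKet n)
    (hv : IsAdmissible x v) (hk : (v.map Prod.fst)[k]? = some q)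
    (hk' : (v.map Prod.fst)[k + 1]? = some q) :
    T.exchange h k x (T.exchange h k x (Finsupp.single v 1)) =
      conj (T.F (some h) (some h) q q q vac * T.F q (some h) (some h) q vac q) •
        Finsupp.single v 1 := by
  induction k generalizing x v with
  | zero =>
    match v with
    | [] => simp at hk
    | [_] => simp at hk'
    | (a, y) :: (b, z) :: s =>
      obtain rfl : a = q := by simpa using hk
      obtain rfl : b = q := by simpa using hk'
      obtain ⟨hy, hz, -⟩ := hv
      rw [exchange_zero, exchange_zero, shift_shift, Finsupp.smul_single, smul_eq_mul, mul_one]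
      congr 1
      -- Two emissions and two absorptions each produce the symbol `F y h h y vac`, once conjugated
      -- and once not. It cancels, and with it all dependence on `x`, `y`, `z`.
      have h1 := congrArg conj (T.F_some_q_mul h hz)
      have h2 := T.F_q_some_mul h hy
      have h3 := T.F_some_some_vac_unit h y
      have h4 : conj (T.F q (some h) (some h) q vac q) * T.F q (some h) (some h) q vac q = 1 :=
        T.F_some_some_vac_unit h q
      simp only [map_mul] at h1 ⊢
      calc _ = (conj (T.F y (some h) q z q (shift h y)) *
              conj (T.F (shift h y) (some h) q z q y)) *
              (T.F x q (some h) y q (shift h y) * T.F x q (some h) (shift h y) q y) := by ring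
        _ = conj (T.F (some h) (some h) q q q vac) *
              conj (T.F y (some h) (some h) y vac (shift h y)) *
              ((conj (T.F q (some h) (some h) q vac q) * T.F q (some h) (some h) q vac q) *
              (T.F x q (some h) y q (shift h y) * T.F x q (some h) (shift h y) q y)) := by
            rw [h1, h4, one_mul]
        _ = conj (T.F (some h) (some h) q q q vac) * conj (T.F q (some h) (some h) q vac q) *
              (conj (T.F y (some h) (some h) y vac (shift h y)) *
              (T.F q (some h) (some h) q vac q *
              (T.F x q (some h) y q (shift h y) * T.F x q (some h) (shift h y) q y))) := by ring
        _ = _ := by rw [← h2, h3, mul_one]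
  | succ k ih =>
    match v with
    | [] => simp at hk
    | (a, y) :: s =>
      rw [exchange_single_cons, exchange_consMap,
        ih y s hv.2 (by simpa using hk) (by simpa using hk'), map_smul, consMap_single]

theorem exists_exchange_single (h : TYGroup n) (k : ℕ) (x : TYCharge n) (v : TYKet n)
    (hv : IsAdmissible x v) (hk : (v.map Prod.fst)[k]? = some q)
    (hk' : (v.map Prod.fst)[k + 1]? = some q) :
    ∃ v' r, T.exchange h k x (Finsupp.single v 1) = Finsupp.single v' r ∧
      v'.map Prod.fst = v.map Prod.fst ∧ IsAdmissible x v' := by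
  induction k generalizing x v with
  | zero =>
    match v with
    | [] => simp at hk
    | [_] => simp at hk'
    | (a, y) :: (b, z) :: s =>
      obtain rfl : a = q := by simpa using hk
      obtain rfl : b = q := by simpa using hk'
      obtain ⟨hy, hz, hs⟩ := hv
      exact ⟨_, _, T.exchange_zero h x y z s 1, rfl, shift_mem_fusion_q h hy,
        mem_fusion_shift_q h hz, hs⟩
  | succ k ih =>
    match v with
    | [] => simp at hk
    | (a, y) :: s =>
      obtain ⟨v', r, h1, h2, h3⟩ := ih y s hv.2 (by simpa using hk) (by simpa using hk')
      exact ⟨(a, y) :: v', r, by rw [exchange_single_cons, h1, consMap_single],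
        by simp [h2], hv.1, h3⟩

end TYTheory

/-! ### Dimension of the fusion space -/

section finrank

open TYCharge TYKet

variable {n : ℕ}

/-- Admissible labellings of `2 p` Tambara-Yamagami anyons to the right of an abelian charge are
sequences of `p` elements of `ℤ₂ⁿ`. -/
theorem card_admissible_replicate_q (p : ℕ) (g : TYGroup n) :
    Nat.card {v : TYKet n | v.map Prod.fst = List.replicate (2 * p) q ∧ IsAdmissible (some g) v} =
      (2 ^ n) ^ p := by
  induction p generalizing g with
  | zero =>
    have : {v : TYKet n | v.map Prod.fst = List.replicate (2 * 0) q ∧ IsAdmissible (some g) v} =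
        {[]} := by
      ext v
      simp only [Set.mem_ofPred_eq, Set.mem_singleton_iff]
      constructor
      · rintro ⟨h, -⟩
        simpa using h
      · rintro rfl
        simp [IsAdmissible]
    rw [this]
    simp
  | succ p ih =>
    let e : (Σ h : TYGroup n, {v : TYKet n | v.map Prod.fst = List.replicate (2 * p) q ∧
        IsAdmissible (some h) v}) ≃ {v : TYKet n |
          v.map Prod.fst = List.replicate (2 * (p + 1)) q ∧ IsAdmissible (some g) v} :=
      -- After one more `q` the running charge must be `q`; after the second it is an arbitrary `h`.
      -- Each pair contributes a factor `2 ^ n`.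
      Equiv.ofBijective (fun w => ⟨(q, q) :: (q, some w.1) :: w.2.1, by
        rw [Set.mem_ofPred_eq, show 2 * (p + 1) = 2 * p + 1 + 1 by ring, List.replicate_succ,
          List.replicate_succ]
        exact ⟨by simp [w.2.2.1], by simp [fusion], by simp [fusion], w.2.2.2⟩⟩) (by
        constructor
        · rintro ⟨h, v, hv⟩ ⟨h', v', hv'⟩ heq
          simp only [Subtype.mk.injEq, List.cons.injEq, Prod.mk.injEq, Option.some.injEq,
            true_and] at heq
          obtain ⟨rfl, rfl⟩ := heq
          rfl
        · rintro ⟨v, hv, ha⟩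
          rw [show 2 * (p + 1) = 2 * p + 1 + 1 by ring, List.replicate_succ,
            List.replicate_succ] at hv
          match v with
          | [] => simp at hv
          | [_] => simp at hv
          | (a, y) :: (b, z) :: s =>
            simp only [List.map_cons, List.cons.injEq] at hv
            obtain ⟨rfl, rfl, hs⟩ := hv
            obtain ⟨hy, hz, ha⟩ := ha
            obtain rfl := mem_fusion_some_q.1 hy
            cases z with
            | none => simp [fusion] at hz
            | some h => exact ⟨⟨h, s, hs, ha⟩, rfl⟩)
    have : ∀ h : TYGroup n, Finite {v : TYKet n | v.map Prod.fst = List.replicate (2 * p) q ∧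
        IsAdmissible (some h) v} := fun h =>
      Nat.finite_of_card_ne_zero (by rw [ih]; positivity)
    rw [← Nat.card_congr e, Nat.card_sigma]
    simp_rw [ih]
    simp [pow_succ, mul_comm]

theorem finrank_fusionSpace_replicate_q (p : ℕ) :
    Module.finrank ℂ (fusionSpace (List.replicate (2 * p) (q : TYCharge n))) = (2 ^ n) ^ p := by
  have hc := card_admissible_replicate_q p (0 : TYGroup n)
  rw [fusionSpace, (Finsupp.supportedEquivFinsupp _).finrank_eq]
  have := Nat.finite_of_card_ne_zero (hc.trans_ne (by positivity))
  have := Fintype.ofFinite {v : TYKet n |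
    v.map Prod.fst = List.replicate (2 * p) q ∧ IsAdmissible (some 0) v}
  rw [Module.finrank_finsupp_self, ← Nat.card_eq_fintype_card, hc]

end finrank

/-! ### Linear extension from admissible trees -/

section fusionSpace

open TYCharge TYKet

variable {n : ℕ} {w : List (TYCharge n)}

theorem fusionSpace_induction {P : TYState n → Prop} (zero : P 0)
    (add : ∀ φ ψ, P φ → P ψ → P (φ + ψ)) (smul : ∀ (r : ℂ) φ, P φ → P (r • φ))
    (single : ∀ v : TYKet n, v.map Prod.fst = w → IsAdmissible vac v → P (Finsupp.single v 1))
    {φ : TYState n} (hφ : φ ∈ fusionSpace w) : P φ := by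
  rw [fusionSpace, Finsupp.supported_eq_span_single] at hφ
  induction hφ using Submodule.span_induction with
  | mem _ h =>
    obtain ⟨v, ⟨h1, h2⟩, rfl⟩ := h
    exact single v h1 h2
  | zero => exact zero
  | add φ ψ _ _ h1 h2 => exact add φ ψ h1 h2
  | smul r φ _ h => exact smul r φ h

theorem eqOn_fusionSpace {f g : TYState n →ₗ[ℂ] TYState n}
    (h : ∀ v : TYKet n, v.map Prod.fst = w → IsAdmissible vac v →
      f (Finsupp.single v 1) = g (Finsupp.single v 1)) {φ : TYState n} (hφ : φ ∈ fusionSpace w) :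
    f φ = g φ :=
  fusionSpace_induction (P := fun φ => f φ = g φ) (by simp) (fun _ _ h1 h2 => by simp [h1, h2])
    (fun _ _ h1 => by simp [h1]) h hφ

end fusionSpace

/-! ### Bob's pair corrections undo Alice's exchanges -/

namespace TYTheory

open TYCharge TYKet

variable {n : ℕ} (T : TYTheory n)

theorem run_append (l l' : List (TYOp n)) (φ : TYState n) :
    T.run (l ++ l') φ = T.run l' (T.run l φ) := by
  induction l generalizing φ with
  | nil => rfl
  | cons o l ih => exact ih _

theorem run_cons (o : TYOp n) (l : List (TYOp n)) (φ : TYState n) :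
    T.run (o :: l) φ = T.run l (T.op o φ) := rfl

theorem run_nil (φ : TYState n) : T.run [] φ = φ := rfl

theorem op_create (k : ℕ) (a : TYCharge n) :
    T.op (.create k a) = act (T.createKet a) k vac := rfl

theorem op_fuse (k : ℕ) (a : TYCharge n) : T.op (.fuse k a) = act (T.fuseKet a) k vac := rfl

theorem op_split (k : ℕ) (a b : TYCharge n) :
    T.op (.split k a b) = act (T.splitKet a b) k vac := rfl

theorem getElem?_of_map_eq_replicate {v : TYKet n} {N k : ℕ}
    (hv : v.map Prod.fst = List.replicate N q) (hk : k < N) :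
    (v.map Prod.fst)[k]? = some q := by
  rw [hv, List.getElem?_replicate, if_pos hk]

theorem exchange_mem_fusionSpace (h : TYGroup n) {N k : ℕ} (hk : k + 1 < N) {φ : TYState n}
    (hφ : φ ∈ fusionSpace (List.replicate N q)) :
    T.exchange h k vac φ ∈ fusionSpace (List.replicate N q) := by
  refine fusionSpace_induction
    (P := fun φ => T.exchange h k vac φ ∈ fusionSpace (List.replicate N q)) (by simp)
    (fun _ _ h1 h2 => ?_) (fun _ _ h1 => ?_) (fun v h1 h2 => ?_) hφ
  · rw [map_add]
    exact Submodule.add_mem _ h1 h2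
  · rw [map_smul]
    exact Submodule.smul_mem _ _ h1
  · obtain ⟨v', r, h3, h4, h5⟩ := T.exists_exchange_single h k vac v h2
      (getElem?_of_map_eq_replicate h1 (by omega)) (getElem?_of_map_eq_replicate h1 hk)
    rw [h3]
    exact Finsupp.single_mem_supported _ _ ⟨h4.trans h1, h5⟩

/-- Bob's correction of the pair of anyons at positions `k` and `k + 1`. -/
noncomputable def pairCorrection (h : TYGroup n) (k : ℕ) (x : TYCharge n) :
    BobMethod → TYState n →ₗ[ℂ] TYState n
  | .splitFromLeft => T.exchangeRight h k x
  | .splitFromRight => T.exchange h k x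
  | .pairCreate => act (T.fuseKet q) (k + 1) x ∘ₗ act (T.fuseKet q) k x ∘ₗ
      act (T.createKet (some h)) (k + 1) x

theorem pairCorrection_consMap (h : TYGroup n) (k : ℕ) (m : BobMethod) (x a y : TYCharge n)
    (ψ : TYState n) :
    T.pairCorrection h (k + 1) x m (consMap (a, y) ψ) =
      consMap (a, y) (T.pairCorrection h k y m ψ) := by
  cases m with
  | splitFromLeft => exact T.exchangeRight_consMap h k x a y ψ
  | splitFromRight => exact T.exchange_consMap h k x a y ψ
  | pairCreate => simp only [pairCorrection, LinearMap.comp_apply, act_consMap]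

/-- The phase is chosen before `N`, `k` and `φ`: it depends only on `h` and the method. -/
theorem exists_pairCorrection_exchange (h : TYGroup n) (m : BobMethod) :
    ∃ ω : ℂ, ‖ω‖ = 1 ∧ ∀ (N k : ℕ), k + 1 < N → ∀ φ ∈ fusionSpace (List.replicate N q),
      T.pairCorrection h k vac m (T.exchange h k vac φ) = ω • φ := by
  have u1 : ‖T.F (some h) (some h) q q q vac‖ = 1 :=
    norm_eq_one_of_conj_mul (T.F_mul_conj_of_unique (by simp [fusion])
      (vac_mem_fusion_self _) (by simp [fusion]))
  have u2 : ‖T.F q (some h) (some h) q vac q‖ = 1 :=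
    norm_eq_one_of_conj_mul (T.F_some_some_vac_unit h q)
  cases m with
  | splitFromLeft =>
    refine ⟨1, norm_one, fun N k hk φ hφ => ?_⟩
    refine eqOn_fusionSpace (f := T.exchangeRight h k vac ∘ₗ T.exchange h k vac)
      (g := (1 : ℂ) • LinearMap.id) (fun v h1 h2 => ?_) hφ
    simpa using T.exchangeRight_exchange h k vac v h2
      (getElem?_of_map_eq_replicate h1 (by omega)) (getElem?_of_map_eq_replicate h1 hk)
  | splitFromRight =>
    refine ⟨conj (T.F (some h) (some h) q q q vac * T.F q (some h) (some h) q vac q),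
      by simp [u1, u2], fun N k hk φ hφ => ?_⟩
    exact eqOn_fusionSpace (f := T.exchange h k vac ∘ₗ T.exchange h k vac)
      (g := conj (T.F (some h) (some h) q q q vac * T.F q (some h) (some h) q vac q) •
        LinearMap.id) (fun v h1 h2 => T.exchange_exchange h k vac v h2
        (getElem?_of_map_eq_replicate h1 (by omega)) (getElem?_of_map_eq_replicate h1 hk)) hφ
  | pairCreate =>
    refine ⟨conj (T.F q (some h) (some h) q vac q), by simp [u2], fun N k hk φ hφ => ?_⟩
    have hE := T.exchange_mem_fusionSpace h hk hφ
    -- Pair-creation and the left absorption amount to splitting off `h` to the right, so the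
    -- remaining fusion completes `exchangeRight`.
    have h1 : act (T.fuseKet q) k vac (act (T.createKet (some h)) (k + 1) vac
        (T.exchange h k vac φ)) = conj (T.F q (some h) (some h) q vac q) •
          act (T.splitKet q (some h)) k vac (T.exchange h k vac φ) :=
      eqOn_fusionSpace (f := act (T.fuseKet q) k vac ∘ₗ act (T.createKet (some h)) (k + 1) vac)
        (g := conj (T.F q (some h) (some h) q vac q) • act (T.splitKet q (some h)) k vac)
        (fun v h1 h2 => T.act_fuse_act_create_eq_split (some h) q k vac v h2
          (getElem?_of_map_eq_replicate h1 (by omega))) hE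
    have h2 : T.exchangeRight h k vac (T.exchange h k vac φ) = φ :=
      eqOn_fusionSpace (f := T.exchangeRight h k vac ∘ₗ T.exchange h k vac)
        (g := LinearMap.id) (fun v h1 h2 => T.exchangeRight_exchange h k vac v h2
          (getElem?_of_map_eq_replicate h1 (by omega)) (getElem?_of_map_eq_replicate h1 hk)) hφ
    simp only [pairCorrection, LinearMap.comp_apply]
    rw [h1, map_smul]
    congr 1

/-- All of Alice's exchanges: the one of `g L` between positions `L - 1` and `L` is done first. -/
noncomputable def exchanges (g : ℕ → TYGroup n) : ℕ → TYState n →ₗ[ℂ] TYState n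
  | 0 => LinearMap.id
  | L + 1 => exchanges g L ∘ₗ T.exchange (g (L + 1)) L vac

/-- All of Bob's corrections but the first. -/
noncomputable def pairCorrections (g : ℕ → TYGroup n) (m : ℕ → BobMethod) :
    ℕ → TYState n →ₗ[ℂ] TYState n
  | 0 => LinearMap.id
  | L + 1 => T.pairCorrection (g (L + 1)) L vac (m (L + 1)) ∘ₗ pairCorrections g m L

theorem exchanges_mem_fusionSpace (g : ℕ → TYGroup n) {N L : ℕ} (hL : L < N) {φ : TYState n}
    (hφ : φ ∈ fusionSpace (List.replicate N q)) :
    T.exchanges g L φ ∈ fusionSpace (List.replicate N q) := by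
  induction L generalizing φ with
  | zero => exact hφ
  | succ L ih => exact ih (by omega) (T.exchange_mem_fusionSpace _ hL hφ)

/-- The exchange with the largest index is done first and corrected last, so the inner corrections
cancel the inner exchanges and the outermost pair of operations remains. -/
theorem exists_pairCorrections_exchanges (g : ℕ → TYGroup n) (m : ℕ → BobMethod) (L : ℕ) :
    ∃ ω : ℂ, ‖ω‖ = 1 ∧ ∀ N, L < N → ∀ φ ∈ fusionSpace (List.replicate N q),
      T.pairCorrections g m L (T.exchanges g L φ) = ω • φ := by
  induction L with
  | zero => exact ⟨1, norm_one, fun N _ φ _ => by simp [exchanges, pairCorrections]⟩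
  | succ L ih =>
    obtain ⟨ω, h1, h2⟩ := ih
    obtain ⟨ω', h1', h2'⟩ := T.exists_pairCorrection_exchange (g (L + 1)) (m (L + 1))
    refine ⟨ω * ω', by simp [h1, h1'], fun N hN φ hφ => ?_⟩
    simp only [exchanges, pairCorrections, LinearMap.comp_apply]
    rw [h2 N (by omega) _ (T.exchange_mem_fusionSpace _ hN hφ), map_smul, h2' N L hN φ hφ,
      smul_smul]

end TYTheory

/-! ### Alice's measurements as exchanges -/

namespace Teleport

open TYCharge TYKet TYTheory

variable {n : ℕ} (T : TYTheory n)

/-- `m` nested pairs, the outermost of which gets the positions `s` and `s + 1` at first. -/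
def creates (n s m : ℕ) : List (TYOp n) := (List.range' s m).map fun k => TYOp.create k q

theorem charlie_eq (N : ℕ) : charlie n N = creates n N N := by
  rw [charlie, creates, List.range'_eq_map_range, List.map_map]
  rfl

/-- A fusion done before the creations leaves one anyon fewer on their left, hence the drop from `s
+ 1` to `s`. -/
theorem fuse_run_creates (c : TYCharge n) {k s : ℕ} (hs : k + 1 ≤ s) (m : ℕ) (φ : TYState n) :
    T.op (.fuse k c) (T.run (creates n (s + 1) m) φ) =
      T.run (creates n s m) (T.op (.fuse k c) φ) := by
  induction m generalizing s φ with
  | zero => rfl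
  | succ m ih =>
    obtain ⟨j, rfl⟩ := Nat.exists_eq_add_of_le hs
    have h1 := act_fuse_act_create T c q k j vac φ
    rw [show k + 2 + j = k + 1 + j + 1 by ring] at h1
    have h2 : ∀ t, creates n t (m + 1) = TYOp.create t q :: creates n (t + 1) m := fun _ => rfl
    rw [h2, h2, run_cons, run_cons, ih (by omega), op_fuse, op_create, h1]
    rfl

/-- Alice's fusions in step `j`. -/
def aliceStep (g : ℕ → TYGroup n) (j : ℕ) : List (TYOp n) :=
  TYOp.fuse j (some (g j)) :: if j = 0 then [] else [TYOp.fuse (j - 1) q]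

/-- The last `L` of Alice's steps. -/
def aliceSteps (g : ℕ → TYGroup n) (L : ℕ) : List (TYOp n) :=
  (List.range L).reverse.flatMap (aliceStep g)

theorem aliceSteps_succ (g : ℕ → TYGroup n) (L : ℕ) :
    aliceSteps g (L + 1) = aliceStep g L ++ aliceSteps g L := by
  simp [aliceSteps, List.range_succ]

theorem alice_eq {N : ℕ} (g : ℕ → TYGroup n) :
    alice (fun j : Fin N => g j) = aliceSteps g N := by
  rw [alice, aliceSteps, ← List.map_coe_finRange_eq_range, ← List.map_reverse, List.flatMap_map]
  rfl

/-- The effect of Alice's measurements on her anyons and her halves of the pairs. -/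
theorem run_creates_aliceSteps (g : ℕ → TYGroup n) {N L : ℕ} (hL : L < N) {φ : TYState n}
    (hφ : φ ∈ fusionSpace (List.replicate N q)) :
    T.run (creates n (L + 1) (L + 1) ++ aliceSteps g (L + 1)) φ =
      (∏ j ∈ Finset.range (L + 1), conj (T.F q q q q vac (some (g j)))) •
        T.op (.split 0 (some (g 0)) q) (T.exchanges g L φ) := by
  have step : ∀ {k}, k < N → ∀ {ψ}, ψ ∈ fusionSpace (List.replicate N q) →
      T.op (.fuse k (some (g k))) (T.op (.create (k + 1) q) ψ) =
        conj (T.F q q q q vac (some (g k))) • T.op (.split k (some (g k)) q) ψ := by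
    intro k hk ψ hψ
    exact eqOn_fusionSpace
      (f := T.op (.fuse k (some (g k))) ∘ₗ T.op (.create (k + 1) q))
      (g := conj (T.F q q q q vac (some (g k))) • T.op (.split k (some (g k)) q))
      (fun v h1 h2 => T.act_fuse_act_create_eq_split q (some (g k)) k vac v h2
        (getElem?_of_map_eq_replicate h1 hk)) hψ
  -- `N` stays fixed while `L` decreases: the new right member of each pair takes the place of the
  -- anyon just consumed, so the state remains one of `N` anyons, with Bob's at the positions beyond
  -- `L`.
  induction L generalizing φ with
  | zero =>
    simpa [creates, aliceSteps, aliceStep, run_cons, run_nil, exchanges] using step hL hφ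
  | succ L ih =>
    have h1 : creates n (L + 1 + 1) (L + 1 + 1) =
        TYOp.create (L + 1 + 1) q :: creates n (L + 1 + 1 + 1) (L + 1) := rfl
    rw [aliceSteps_succ, h1, aliceStep, if_neg (by omega), Nat.add_sub_cancel, run_append,
      run_append, run_cons, run_cons, run_cons, run_nil, fuse_run_creates T _ le_rfl, step hL hφ,
      fuse_run_creates T _ le_rfl, map_smul, map_smul, map_smul, Finset.prod_range_succ, mul_comm,
      mul_smul, ← run_append]
    have h2 := ih (by omega) (T.exchange_mem_fusionSpace (g (L + 1)) hL hφ)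
    exact congrArg _ h2

end Teleport

/-! ### Bob's corrections and the whole procedure -/

namespace Teleport

open TYCharge TYKet TYTheory

variable {n : ℕ} (T : TYTheory n)

theorem withAncilla_eq (h : TYGroup n) (φ : TYState n) :
    withAncilla h φ = consMap (some h, some h) (consMap (some h, vac) φ) := by
  simp only [withAncilla, consMap, Finsupp.lmapDomain_apply, ← Finsupp.mapDomain_comp]
  rfl

/-- The two leftover anyons have vacuum total charge, so Bob's later corrections act behind them,
two positions further on, as on a line starting from the vacuum. -/
theorem run_correction_succ (h h' : TYGroup n) (j : ℕ) (m : BobMethod) (φ : TYState n) :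
    T.run (correction h (j + 1) m) (withAncilla h' φ) =
      withAncilla h' (T.pairCorrection h j vac m φ) := by
  rw [withAncilla_eq, withAncilla_eq, ← T.pairCorrection_consMap h j m (some h') (some h') vac,
    ← T.pairCorrection_consMap h (j + 1) m vac (some h') (some h')]
  cases m <;> rfl

/-- Bob's first correction turns the anyon that Alice is left with into a pair of vacuum total
charge. -/
theorem exists_run_correction_zero (h : TYGroup n) (m : BobMethod) :
    ∃ ω : ℂ, ‖ω‖ = 1 ∧ ∀ N, ∀ φ ∈ fusionSpace (List.replicate (N + 1) q),
      T.run (correction h 0 m) (T.op (.split 0 (some h) q) φ) = ω • withAncilla h φ := by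
  have v0 : shift h vac = some h := by simp [shift]
  have v1 : shift h (some h) = vac := by rw [← v0, shift_shift]
  have hsplit : ∀ s : TYKet n, T.op (.split 0 (some h) q) (Finsupp.single ((q, q) :: s) 1) =
      Finsupp.single ((some h, some h) :: (q, q) :: s) 1 := by
    intro s
    rw [op_split, act_split_zero, sum_single_eq _ _ (some h)]
    · rw [T.triangle _ _ _ _ _ _ (by simp) (mem_fusion_vac_left.2 rfl) (by simp [fusion])
        (by simp [fusion]) (mem_fusion_vac_left.2 rfl)]
      simp
    · intro w hw
      rw [T.F_eq_zero vac (some h) q q q w (fun hh => hw (mem_fusion_vac_left.1 hh.1))]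
      simp
  have hcorr : ∀ m : BobMethod, ∃ ω : ℂ, ‖ω‖ = 1 ∧ ∀ s : TYKet n,
      T.run (correction h 0 m) (Finsupp.single ((some h, some h) :: (q, q) :: s) 1) =
        ω • withAncilla h (Finsupp.single ((q, q) :: s) 1) := by
    have u1 : ‖T.F (some h) (some h) q q q vac‖ = 1 :=
      norm_eq_one_of_conj_mul (T.F_mul_conj_of_unique (by simp [fusion])
        (vac_mem_fusion_self _) (by simp [fusion]))
    have hs : ∀ s : TYKet n, T.op (.split 1 (some h) q)
        (Finsupp.single ((some h, some h) :: (q, q) :: s) 1) =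
          conj (T.F (some h) (some h) q q q vac) •
            withAncilla h (Finsupp.single ((q, q) :: s) 1) := by
      intro s
      rw [op_split, act_single_cons, act_split_zero, sum_single_eq _ _ vac]
      · simp [withAncilla_eq, consMap_single]
      · intro w hw
        rw [T.F_eq_zero (some h) (some h) q q q w
          (fun hh => hw ((mem_fusion_some.1 hh.1).trans v1))]
        simp
    rintro (_ | _ | _)
    · exact ⟨_, by simpa using u1, hs⟩
    · exact ⟨_, by simpa using u1, hs⟩
    · have u2 := norm_eq_one_of_conj_mul (T.F_some_some_vac_unit h (some h))
      have u3 := norm_eq_one_of_conj_mul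
        (T.F_some_q_unit h (y := vac) (z := q) (mem_fusion_vac_left.2 rfl))
      rw [v1] at u2
      rw [v0] at u3
      -- The running charges to the left of Bob's first anyon are fixed, so creation and fusion
      -- contribute one constant phase each.
      refine ⟨conj (T.F (some h) (some h) (some h) (some h) vac vac) *
        T.F vac (some h) q q q (some h), by simp [u2, u3], fun s => ?_⟩
      have hc : correction h 0 .pairCreate =
        [TYOp.create (0 + 1) (some h), TYOp.fuse (0 + 1 + 1) q] := rfl
      rw [hc, run_cons, run_cons, run_nil, op_create, op_fuse, act_single_cons, act_consMap,
        act_create_zero, sum_single_eq _ _ vac, act_single_cons, act_fuse_zero]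
      · simp only [withAncilla_eq, consMap_single, one_mul, Finsupp.smul_single, smul_eq_mul,
          mul_one]
      · intro w hw
        rw [T.F_eq_zero (some h) (some h) (some h) (some h) vac w
          (fun hh => hw ((mem_fusion_some.1 hh.1).trans v1))]
        simp
  obtain ⟨ω, h1, h2⟩ := hcorr m
  refine ⟨ω, h1, fun N φ hφ => ?_⟩
  refine eqOn_fusionSpace (f := T.run (correction h 0 m) ∘ₗ T.op (.split 0 (some h) q))
    (g := ω • withAncilla h) (fun v hv ha => ?_) hφ
  match v with
  | [] => simp [List.replicate_succ] at hv
  | (a, y) :: s =>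
    obtain rfl : a = q := by
      rw [List.replicate_succ] at hv
      exact (List.cons.inj hv).1
    obtain rfl : y = q := mem_fusion_some_q.1 ha.1
    rw [LinearMap.comp_apply, hsplit, h2, LinearMap.smul_apply]

/-- The first `L` of Bob's corrections. -/
def bobSteps (g : ℕ → TYGroup n) (m : ℕ → BobMethod) (L : ℕ) : List (TYOp n) :=
  (List.range L).flatMap fun j => correction (g j) j (m j)

theorem bob_eq {N : ℕ} (g : ℕ → TYGroup n) (m : ℕ → BobMethod) :
    bob (fun j : Fin N => g j) (fun j => m j) = bobSteps g m N := by
  rw [bob, bobSteps, ← List.map_coe_finRange_eq_range, List.flatMap_map]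

theorem bobSteps_succ (g : ℕ → TYGroup n) (m : ℕ → BobMethod) (L : ℕ) :
    bobSteps g m (L + 1) = bobSteps g m L ++ correction (g L) L (m L) := by
  simp [bobSteps, List.range_succ]

theorem run_bobSteps (g : ℕ → TYGroup n) (m : ℕ → BobMethod) (L : ℕ) {ω : ℂ} {φ ψ : TYState n}
    (h : T.run (correction (g 0) 0 (m 0)) ψ = ω • withAncilla (g 0) φ) :
    T.run (bobSteps g m (L + 1)) ψ = ω • withAncilla (g 0) (T.pairCorrections g m L φ) := by
  induction L with
  | zero => simpa [bobSteps, pairCorrections] using h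
  | succ L ih =>
    rw [bobSteps_succ, run_append, ih, map_smul, run_correction_succ]
    rfl

theorem exists_run_procedure (g : ℕ → TYGroup n) (m : ℕ → BobMethod) (N : ℕ) :
    ∃ ω : ℂ, ‖ω‖ = 1 ∧ ∀ φ ∈ fusionSpace (List.replicate (N + 1) q),
      T.run (creates n (N + 1) (N + 1) ++ aliceSteps g (N + 1) ++ bobSteps g m (N + 1)) φ =
        (ω * ∏ j ∈ Finset.range (N + 1), conj (T.F q q q q vac (some (g j)))) •
          withAncilla (g 0) φ := by
  obtain ⟨ω₁, h1, h1'⟩ := exists_run_correction_zero T (g 0) (m 0)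
  obtain ⟨ω₂, h2, h2'⟩ := T.exists_pairCorrections_exchanges g m N
  refine ⟨ω₁ * ω₂, by simp [h1, h2], fun φ hφ => ?_⟩
  have hE := T.exchanges_mem_fusionSpace g N.lt_succ_self hφ
  rw [run_append, run_creates_aliceSteps T g N.lt_succ_self hφ, map_smul,
    run_bobSteps T g m N (h1' N _ hE), h2' (N + 1) N.lt_succ_self φ hφ, map_smul, smul_smul,
    smul_smul]
  congr 1
  ring

theorem norm_prod_F (g : ℕ → TYGroup n) (p : ℕ) :
    ‖∏ j ∈ Finset.range (2 * p), conj (T.F q q q q vac (some (g j)))‖ = (((2 : ℝ) ^ n) ^ p)⁻¹ := by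
  -- Squares are compared because only the squared moduli of the factors are rational; the `2 * p`
  -- factors make up for it.
  refine (pow_left_inj₀ (norm_nonneg _) (by positivity) two_ne_zero).1 ?_
  simp only [norm_prod, RCLike.norm_conj]
  rw [← Finset.prod_pow]
  simp_rw [norm_F_q_vac_sq]
  rw [Finset.prod_const, Finset.card_range, inv_pow, inv_pow, ← pow_mul _ p 2, mul_comm p]

theorem isCreateOrFuse_of_mem_procedure {N : ℕ} (g : Fin N → TYGroup n) (m : Fin N → BobMethod)
    (hm : ∀ j, m j = .pairCreate) : ∀ o ∈ procedure g m, o.IsCreateOrFuse := by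
  intro o ho
  simp only [procedure, List.mem_append, charlie, alice, bob, List.mem_map,
    List.mem_flatMap] at ho
  obtain (⟨k, -, rfl⟩ | ⟨j, -, hj⟩) | ⟨j, -, hj⟩ := ho
  · trivial
  · rw [List.mem_cons] at hj
    obtain rfl | hj := hj
    · trivial
    · split_ifs at hj
      · simp at hj
      · obtain rfl := List.mem_singleton.1 hj
        trivial
  · rw [hm] at hj
    cases h : (j : ℕ) with
    | zero =>
      simp only [h, correction, List.mem_cons, List.not_mem_nil, or_false] at hj
      obtain rfl | rfl := hj <;> trivial
    | succ i =>
      simp only [h, correction, List.mem_cons, List.not_mem_nil, or_false] at hj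
      obtain rfl | rfl | rfl := hj <;> trivial

end Teleport

theorem theorem5p1 (n : ℕ) (hn : 1 ≤ n) (T : TYTheory n) (p : ℕ) (hp : 1 ≤ p) :
    Module.finrank ℂ (fusionSpace (List.replicate (2 * p) (TYCharge.q : TYCharge n)))
        = (2 ^ n) ^ p ∧
    ∀ (g : Fin (2 * p) → TYGroup n) (m : Fin (2 * p) → BobMethod),
      (∃ ω : ℂ, ‖ω‖ = 1 ∧
        ∀ φ ∈ fusionSpace (List.replicate (2 * p) (TYCharge.q : TYCharge n)),
          T.run (Teleport.procedure g m) φ =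
            (ω / ((2 : ℂ) ^ n) ^ p) • Teleport.withAncilla (g ⟨0, by omega⟩) φ) ∧
      ((∀ j, m j = BobMethod.pairCreate) →
        ∀ o ∈ Teleport.procedure g m, o.IsCreateOrFuse) := by
  refine ⟨finrank_fusionSpace_replicate_q p, fun g m =>
    ⟨?_, Teleport.isCreateOrFuse_of_mem_procedure g m⟩⟩
  -- Outcomes and methods are extended to all of `ℕ` for the inductions; the default values are
  -- never read.
  obtain ⟨g', rfl⟩ : ∃ g' : ℕ → TYGroup n, (fun j : Fin (2 * p) => g' j) = g :=
    ⟨fun j => if h : j < 2 * p then g ⟨j, h⟩ else 0, by ext; simp⟩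
  obtain ⟨m', rfl⟩ : ∃ m' : ℕ → BobMethod, (fun j : Fin (2 * p) => m' j) = m :=
    ⟨fun j => if h : j < 2 * p then m ⟨j, h⟩ else .pairCreate, by ext; simp⟩
  obtain ⟨N, hN⟩ : ∃ N, 2 * p = N + 1 := ⟨2 * p - 1, by omega⟩
  obtain ⟨ω, h1, h2⟩ := Teleport.exists_run_procedure T g' m' N
  rw [← hN] at h2
  -- The product of `F`-entries has modulus `1 / (2 ^ n) ^ p`; multiplying by `(2 ^ n) ^ p` leaves
  -- its phase.
  refine ⟨ω * (∏ j ∈ Finset.range (2 * p), conj (T.F .q .q .q .q .vac (some (g' j)))) *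
    ((2 : ℂ) ^ n) ^ p, ?_, fun φ hφ => ?_⟩
  · rw [norm_mul, norm_mul, h1, Teleport.norm_prod_F]
    simp
  · rw [Teleport.procedure, Teleport.charlie_eq, Teleport.alice_eq, Teleport.bob_eq, h2 φ hφ,
      mul_div_cancel_right₀ _ (pow_ne_zero _ (pow_ne_zero _ two_ne_zero))]
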